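/- Let $q\ge 2$ and $n\ge 2$ be integers, and consider $n$ qudits of local dimension $q$, with computational basis $|0\rangle,\dots,|q-1\rangle$ on each. Let $U_1,\dots,U_{n-1}$ be independent Haar-random unitaries in $U(q^2)$, with $U_i$ acting on qudits $i$ and $i+1$ (and as the identity on the others). The convolutional circuit is $U(\mathcal C)=U_{n-1}\cdots U_2U_1$. The idle qudits are the first $n-1$ qudits. The rewinding circuit $\mathcal R$ applies, in reverse order, the inverses of all gates of $\mathcal C$ that act only on idle qudits, i.e. $\mathcal R=U_1^\dagger U_2^\dagger\cdots U_{n-2}^\dagger$. Let $|\psi_n\rangle=\mathcal R\,U(\mathcal C)\,|0^n\rangle$, and define the Haar-averaged fidelity of resetting the first qudit by $$F_1(n)=\int \langle\psi_n|\,(|0\rangle\langle 0|_1\otimes I)\,|\psi_n\rangle\; d\mu(U_1)\cdots d\mu(U_{n-1}),$$ where $\mu$ is the Haar probability measure on $U(q^2)$. Then the integrand is integrable, and for every $n\ge 2$ $$F_1(n)=1-\frac{q-1}{q}\left(\frac{q^2}{q^2+1}\right)^{n-2}.$$ Consequently, for fixed $q$ the infidelity $1-F_1(n)$ converges to $0$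 as $n\to\infty$, at the rate $\frac{q^2}{q^2+1}$: $$\lim_{n\to\infty}\bigl(1-F_1(n)\bigr)=0,\qquad \lim_{n\to\infty}\frac{1-F_1(n+1)}{1-F_1(n)}=\frac{q^2}{q^2+1}.$$ -/

import Mathlib

open MeasureTheory Filter Topology

noncomputable section

namespace ConvCircuit

/-- The group `U(q²)` of two-qudit gates, acting on `ℂ^q ⊗ ℂ^q` with basis `Fin q × Fin q`. -/
abbrev TwoQuditUnitary (q : ℕ) : Type := Matrix.unitaryGroup (Fin q × Fin q) ℂ

/-- The computational basis of `n` qudits of local dimension `q`. -/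
abbrev Config (n q : ℕ) : Type := Fin n → Fin q

instance instMeasurableSpaceTwoQuditUnitary (q : ℕ) : MeasurableSpace (TwoQuditUnitary q) :=
  borel _

instance instBorelSpaceTwoQuditUnitary (q : ℕ) : BorelSpace (TwoQuditUnitary q) := ⟨rfl⟩

instance instCompactSpaceTwoQuditUnitary (q : ℕ) : CompactSpace (TwoQuditUnitary q) := by
  apply isCompact_iff_compactSpace.mp
  have hK : IsCompact (Set.univ.pi fun _ : Fin q × Fin q =>
      Set.univ.pi fun _ : Fin q × Fin q => Metric.closedBall (0 : ℂ) 1) :=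
    isCompact_univ_pi fun _ => isCompact_univ_pi fun _ => isCompact_closedBall 0 1
  refine IsCompact.of_isClosed_subset hK ?_ ?_
  · exact isClosed_unitary (R := Matrix (Fin q × Fin q) (Fin q × Fin q) ℂ)
  · intro U hU i _ j _
    simpa using entry_norm_bound_of_unitary hU i j

/-- The Haar probability measure on the group of two-qudit gates. -/
def haarGate (q : ℕ) : Measure (TwoQuditUnitary q) :=
  Measure.haarMeasure ⊤

instance instIsProbabilityMeasureHaarGate (q : ℕ) : IsProbabilityMeasure (haarGate q) :=
  ⟨by simpa [haarGate] using
    (Measure.haarMeasure_self (K₀ := (⊤ : TopologicalSpace.PositiveCompacts (TwoQuditUnitary q))))⟩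

instance instIsHaarMeasureHaarGate (q : ℕ) : (haarGate q).IsHaarMeasure := by
  unfold haarGate; infer_instance

/-- A two-qudit gate placed on the ordered pair of distinct sites `(i, j)` of `n` qudits. -/
structure Gate (n q : ℕ) where
  i : Fin n
  j : Fin n
  ne : i ≠ j
  U : TwoQuditUnitary q

/-- The set of qudits on which a gate acts. -/
def Gate.support {n q : ℕ} (g : Gate n q) : Finset (Fin n) := {g.i, g.j}

/-- The operator on all `n` qudits: `U` on the sites `i, j`, tensored with the identity on the
other sites. -/
def Gate.toMatrix {n q : ℕ} (g : Gate n q) : Matrix (Config n q) (Config n q) ℂ :=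
  Matrix.of fun x y =>
    if ∀ k, k ≠ g.i → k ≠ g.j → x k = y k then g.U.1 (x g.i, x g.j) (y g.i, y g.j) else 0

/-- The gate `g†`. -/
def Gate.dagger {n q : ℕ} (g : Gate n q) : Gate n q := { g with U := star g.U }

/-- The unitary `g_N ⋯ g_2 g_1` implemented by the sequence of gates `(g_1, g_2, …, g_N)`. -/
def circuitUnitary {n q : ℕ} (C : List (Gate n q)) : Matrix (Config n q) (Config n q) ℂ :=
  (C.map Gate.toMatrix).reverse.prod

/-- The rewinding circuit `(g̃_{N'}†, …, g̃_1†)`, where `(g̃_1, …, g̃_{N'})` is the subsequence of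
those gates of `C` that act only on qudits of the set `idle`. -/
def rewinding {n q : ℕ} (idle : Finset (Fin n)) (C : List (Gate n q)) : List (Gate n q) :=
  ((C.filter fun g => g.support ⊆ idle).map Gate.dagger).reverse

/-- The initial state `|0^n⟩`. -/
def zeroState (n q : ℕ) [NeZero q] : Config n q → ℂ := Pi.single (fun _ => 0) 1

/-- The state `R U(C) |0^n⟩` after the circuit `C` and then its rewinding circuit `R`. -/
def rewoundState {n q : ℕ} [NeZero q] (idle : Finset (Fin n)) (C : List (Gate n q)) :
    Config n q → ℂ :=
  (circuitUnitary (rewinding idle C) * circuitUnitary C).mulVec (zeroState n q)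

/-- The projector `|0⟩⟨0|_k ⊗ I` onto the state `|0⟩` of the `k`-th qudit. -/
def zeroProj {n q : ℕ} [NeZero q] (k : Fin n) : Matrix (Config n q) (Config n q) ℂ :=
  Matrix.diagonal fun x => if x k = 0 then 1 else 0

/-- The fidelity `⟨ψ| (|0⟩⟨0|_k ⊗ I) |ψ⟩` of the `k`-th qudit (a real number, see
`fidelity_eq_sum`). -/
def fidelity {n q : ℕ} [NeZero q] (k : Fin n) (ψ : Config n q → ℂ) : ℝ :=
  (star ψ ⬝ᵥ (zeroProj k).mulVec ψ).re

theorem fidelity_eq_sum {n q : ℕ} [NeZero q] (k : Fin n) (ψ : Config n q → ℂ) :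
    star ψ ⬝ᵥ (zeroProj k).mulVec ψ = ((∑ x, if x k = 0 then ‖ψ x‖ ^ 2 else 0 : ℝ) : ℂ) := by
  simp only [zeroProj, dotProduct, Matrix.mulVec_diagonal, Pi.star_apply, Complex.ofReal_sum]
  refine Finset.sum_congr rfl fun x _ => ?_
  split_ifs
  · simpa using Complex.conj_mul' (ψ x)
  · simp

/-- The convolutional circuit `U_{n-1} ⋯ U_2 U_1`: the gate `U_i` acts on the `i`-th and the
`(i+1)`-st qudit, and the gates are applied in the order of increasing `i`
(sites and gates are counted from `0` here). -/
def convolutionalCircuit {n q : ℕ} (U : Fin (n - 1) → TwoQuditUnitary q) : List (Gate n q) :=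
  List.ofFn fun a : Fin (n - 1) =>
    { i := ⟨a, by omega⟩
      j := ⟨a + 1, by omega⟩
      ne := by simp [Fin.ext_iff]
      U := U a }

/-- All qudits but the last one: after the convolutional circuit on `n` qudits, the gates still to
come (if any) act on the last of them and on later qudits only. -/
def idleQudits (n : ℕ) : Finset (Fin n) := Finset.univ.filter fun k => (k : ℕ) + 1 < n

/-- The fidelity of resetting the first qudit by rewinding the convolutional circuit with gates
`U`. -/
def convFidelity {q : ℕ} [NeZero q] (n : ℕ) (hn : 2 ≤ n) (U : Fin (n - 1) → TwoQuditUnitary q) :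
    ℝ :=
  fidelity ⟨0, by omega⟩ (rewoundState (idleQudits n) (convolutionalCircuit U))

/-- The fidelity `F_1` of resetting the first qudit, averaged over independent Haar-random
gates. -/
def avgFidelity (q : ℕ) [NeZero q] (n : ℕ) (hn : 2 ≤ n) : ℝ :=
  ∫ U, convFidelity n hn U ∂(Measure.pi fun _ : Fin (n - 1) => haarGate q)

end ConvCircuit

end

noncomputable section

namespace ConvCircuit

open scoped Matrix

/-! ### Unitarily covariant maps on matrices -/

section Twirl

variable {d : Type*} [Fintype d] [DecidableEq d]

/-! Count sites from `0`, put `n = N + 2`, and let `V_k` (`prefixOp`) be the product of the first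
`k` gates and `P` the projector on site `0`. The rewound operator is `V_N† V_{N+1}`, the last gate
conjugated by `V_N`, and the fidelity is the form `⟨0|A† P A|0⟩` (`resetForm`) at this operator.
Everything follows from averaging one gate at a time, latest first.

The last gate enters linearly in `A`, so the moments of `integral_star_mul_gate` replace it by the
sum of all matrix units on its two sites. Units on the new site commute with `V_N` and `P` and sum
out, leaving `w_N / q`. Here `w_k` (`insertedForm`) sums the form over `V_k† E_ab V_k`, with `E_ab`
the matrix units on site `k`.

In `w_{k+1}` the gate `U` numbered `k` enters through `M_ab = U† (1 ⊗ E_ab) U`. The average of `X ↦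
∑ M_ab X M_ab†` is unitarily covariant, hence `a X + b tr(X) 1` (`exists_eq_smul_add_trace_smul`),
and two traces force `a = b = q / (q² + 1)`. The `a` part contributes the form at the identity,
which is `1`; the `b` part contributes `q w_k`. So `E w_{k+1} = q / (q² + 1) * (1 + q E w_k)` with
`w_0 = 1`: an affine recursion with fixed point `q` and contraction factor `q² / (q² + 1)`. -/

theorem swap_permMatrix_mem_unitary (i j : d) :
    (Equiv.swap i j).permMatrix ℂ ∈ Matrix.unitaryGroup d ℂ := by
  rw [Matrix.mem_unitaryGroup_iff, Matrix.star_eq_conjTranspose, Matrix.conjTranspose_permMatrix,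
    ← Matrix.permMatrix_mul]
  simp

theorem signMatrix_mem_unitary (j : d) :
    (Matrix.diagonal fun k => if k = j then (-1 : ℂ) else 1) ∈ Matrix.unitaryGroup d ℂ := by
  rw [Matrix.mem_unitaryGroup_iff, Matrix.star_eq_conjTranspose, Matrix.diagonal_conjTranspose,
    Matrix.diagonal_mul_diagonal, ← Matrix.diagonal_one]
  congr 1
  ext k
  by_cases h : k = j <;> simp [h]

/-- A linear map vanishing on all rank-one projectors `W E_kk W†` is zero. -/
theorem eq_zero_of_conj_single_eq_zero {E : Type*} [AddCommGroup E] [Module ℂ E]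
    (T : Matrix d d ℂ →ₗ[ℂ] E)
    (h : ∀ W ∈ Matrix.unitaryGroup d ℂ, ∀ k, T (W * Matrix.single k k 1 * Wᴴ) = 0) : T = 0 := by
  -- By the spectral theorem a Hermitian matrix is a combination of such projectors; Hermitian
  -- matrices span all matrices over `ℂ`.
  have key : ∀ A : Matrix d d ℂ, A.IsHermitian → T A = 0 := by
    intro A hA
    have hs := hA.spectral_theorem
    rw [Unitary.conjStarAlgAut_apply] at hs
    rw [hs, ← Matrix.sum_single_eq_diagonal, Finset.mul_sum, Finset.sum_mul, map_sum]
    refine Finset.sum_eq_zero fun k _ => ?_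
    have := h _ hA.eigenvectorUnitary.2 k
    rw [show ∀ c : ℂ, Matrix.single k k c = c • Matrix.single k k 1 by
      intro c; simp, Matrix.mul_smul, Matrix.smul_mul, map_smul]
    rw [Matrix.star_eq_conjTranspose, this, smul_zero]
  ext1 X
  have h1 : (X + Xᴴ).IsHermitian := by
    simp [Matrix.IsHermitian, add_comm]
  have h2 : (Complex.I • (X - Xᴴ)).IsHermitian := by
    simp only [Matrix.IsHermitian, Matrix.conjTranspose_smul, Matrix.conjTranspose_sub,
      Matrix.conjTranspose_conjTranspose]
    simp only [smul_sub, Complex.star_def, Complex.conj_I, neg_smul]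
    abel
  have e : X = (1 / 2 : ℂ) • (X + Xᴴ) - (Complex.I / 2) • (Complex.I • (X - Xᴴ)) := by
    rw [smul_smul, show Complex.I / 2 * Complex.I = -(1 / 2) by
      rw [div_mul_eq_mul_div, Complex.I_mul_I]; ring]
    module
  rw [e, map_sub, map_smul, map_smul, key _ h1, key _ h2]
  simp

/-- A unitarily covariant linear map on matrices is a combination of the identity and the
completely depolarizing map. -/
theorem exists_eq_smul_add_trace_smul [Nontrivial d] (T : Matrix d d ℂ →ₗ[ℂ] Matrix d d ℂ)
    (hT : ∀ W ∈ Matrix.unitaryGroup d ℂ, ∀ X, T (W * X * Wᴴ) = W * T X * Wᴴ) :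
    ∃ a b : ℂ, ∀ X, T X = a • X + (b * X.trace) • (1 : Matrix d d ℂ) := by
  have swapconj : ∀ (i j : d) (X : Matrix d d ℂ),
      (Equiv.swap i j).permMatrix ℂ * X * ((Equiv.swap i j).permMatrix ℂ)ᴴ
        = X.submatrix (Equiv.swap i j) (Equiv.swap i j) := by
    intro i j X
    rw [Matrix.conjTranspose_permMatrix, Equiv.Perm.permMatrix, PEquiv.toMatrix_toPEquiv_mul,
      Equiv.Perm.permMatrix, PEquiv.mul_toMatrix_toPEquiv]
    ext a b
    simp
  have hswap : ∀ i j X, T (X.submatrix (Equiv.swap i j) (Equiv.swap i j))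
      = (T X).submatrix (Equiv.swap i j) (Equiv.swap i j) := by
    intro i j X
    rw [← swapconj, hT _ (swap_permMatrix_mem_unitary i j), swapconj]
  have hsub : ∀ (i j k : d), (Matrix.single k k (1 : ℂ)).submatrix (Equiv.swap i j) (Equiv.swap i j)
      = Matrix.single (Equiv.swap i j k) (Equiv.swap i j k) 1 := by
    intro i j k
    ext a b
    simp only [Matrix.submatrix_apply, Matrix.single_apply, Equiv.swap_apply_eq_iff]
  -- Flipping the sign of basis vector `j` fixes `E_kk` but negates the `(i, j)` entry of its image.
  have hoff : ∀ k i j, i ≠ j → T (Matrix.single k k 1) i j = 0 := by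
    intro k i j hij
    have h := hT _ (signMatrix_mem_unitary j) (Matrix.single k k 1)
    rw [Matrix.diagonal_conjTranspose] at h
    have e : (Matrix.diagonal fun l => if l = j then (-1 : ℂ) else 1) * Matrix.single k k 1 *
        Matrix.diagonal (star fun l => if l = j then (-1 : ℂ) else 1) = Matrix.single k k 1 := by
      ext a b
      rw [Matrix.mul_diagonal, Matrix.diagonal_mul, Matrix.single_apply]
      by_cases hk : k = a ∧ k = b
      · obtain ⟨rfl, rfl⟩ := hk
        by_cases h : k = j <;> simp [h]
      · simp [hk]
    rw [e] at h
    have h' := congrFun (congrFun h i) j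
    rw [Matrix.mul_diagonal, Matrix.diagonal_mul] at h'
    simp [hij] at h'
    linear_combination (1 / 2 : ℂ) * h'
  -- Permutation covariance: the `l`-th diagonal entry of `T E_kk` can depend only on whether `l =
  -- k`, which leaves two constants.
  have hdiag : ∀ i j k l, T (Matrix.single (Equiv.swap i j k) (Equiv.swap i j k) 1)
      (Equiv.swap i j l) (Equiv.swap i j l) = T (Matrix.single k k 1) l l := by
    intro i j k l
    rw [← hsub, hswap]
    simp
  obtain ⟨k₀, l₀, hkl⟩ := exists_pair_ne d
  have hfix : ∀ i, i ≠ k₀ → T (Matrix.single k₀ k₀ 1) i i = T (Matrix.single k₀ k₀ 1) l₀ l₀ := by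
    intro i hi
    have := hdiag i l₀ k₀ i
    rw [Equiv.swap_apply_of_ne_of_ne hi.symm hkl, Equiv.swap_apply_left] at this
    exact this.symm
  have hne : ∀ k i, i ≠ k → T (Matrix.single k k 1) i i = T (Matrix.single k₀ k₀ 1) l₀ l₀ := by
    intro k i hi
    rw [← hdiag k k₀ k i, Equiv.swap_apply_left]
    refine hfix _ fun h => hi ?_
    rwa [Equiv.swap_apply_eq_iff, Equiv.swap_apply_right] at h
  have heq : ∀ k, T (Matrix.single k k 1) k k = T (Matrix.single k₀ k₀ 1) k₀ k₀ := by
    intro k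
    rw [← hdiag k k₀ k k, Equiv.swap_apply_left]
  set b := T (Matrix.single k₀ k₀ 1) l₀ l₀
  set a := T (Matrix.single k₀ k₀ 1) k₀ k₀ - b with ha
  have hE : ∀ k, T (Matrix.single k k 1) = a • Matrix.single k k 1 + b • (1 : Matrix d d ℂ) := by
    intro k
    ext i j
    by_cases hij : i = j
    · subst hij
      by_cases hi : i = k
      · subst hi
        simp [heq, ha]
      · simp [hne k i hi, Ne.symm hi]
    · rw [hoff k i j hij]
      have : ¬ (k = i ∧ k = j) := fun h => hij (h.1.symm.trans h.2)
      simp [hij, this]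
  refine ⟨a, b, fun X => ?_⟩
  -- The difference of the two covariant maps vanishes on each `E_kk`, hence on each conjugate `W
  -- E_kk W†`.
  have h0 := eq_zero_of_conj_single_eq_zero
    (T - (a • LinearMap.id + b • (Matrix.traceLinearMap d ℂ ℂ).smulRight (1 : Matrix d d ℂ)))
    (fun W hW k => by
      have hW' : W * Wᴴ = 1 := Matrix.mem_unitaryGroup_iff.mp hW
      have hW2 : Wᴴ * W = 1 := Matrix.mem_unitaryGroup_iff'.mp hW
      simp only [LinearMap.sub_apply, LinearMap.add_apply, LinearMap.smul_apply,
        LinearMap.id_apply, LinearMap.smulRight_apply, Matrix.traceLinearMap_apply]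
      rw [hT W hW, hE, Matrix.trace_mul_comm, ← Matrix.mul_assoc, hW2]
      simp [Matrix.mul_add, Matrix.add_mul, hW', -Matrix.smul_single])
  have := LinearMap.congr_fun h0 X
  simp only [LinearMap.sub_apply, LinearMap.add_apply, LinearMap.smul_apply, LinearMap.id_apply,
    LinearMap.smulRight_apply, Matrix.traceLinearMap_apply, LinearMap.zero_apply] at this
  rw [sub_eq_zero.mp this, smul_smul]

end Twirl

/-! ### Topology of the gate group and right invariance of its Haar measure -/

section Haar

variable {q : ℕ}

/-- With this the product σ-algebra on tuples of gates is the Borel one, so continuous functions of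
all gates are measurable. -/
instance : SecondCountableTopology (TwoQuditUnitary q) :=
  have : SecondCountableTopology (Matrix (Fin q × Fin q) (Fin q × Fin q) ℂ) :=
    inferInstanceAs (SecondCountableTopology (Fin q × Fin q → Fin q × Fin q → ℂ))
  TopologicalSpace.Subtype.secondCountableTopology
    (Matrix.unitaryGroup (Fin q × Fin q) ℂ : Set (Matrix (Fin q × Fin q) (Fin q × Fin q) ℂ))

/-- A right translate of Haar measure is again a left-invariant probability measure, so uniqueness
applies. -/
instance : (haarGate q).IsMulRightInvariant where
  map_mul_right_eq_self g := by
    have : IsProbabilityMeasure (Measure.map (· * g) (haarGate q)) :=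
      Measure.isProbabilityMeasure_map (measurable_mul_const g).aemeasurable
    exact Measure.isHaarMeasure_eq_of_isProbabilityMeasure _ _

end Haar

/-! ### Resampling one of several independent variables -/

section Update

variable {ι : Type*} [Fintype ι] [DecidableEq ι] {α : Type*} [MeasurableSpace α]
  (ν : Measure α) [IsProbabilityMeasure ν]

/-- Resampling one coordinate of a product measure preserves it. -/
theorem measurePreserving_update (k : ι) :
    MeasurePreserving (fun p : (ι → α) × α => Function.update p.1 k p.2)
      ((Measure.pi fun _ : ι => ν).prod ν) (Measure.pi fun _ : ι => ν) := by
  have hm : Measurable fun p : (ι → α) × α => Function.update p.1 k p.2 := by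
    rw [measurable_pi_iff]
    intro i
    by_cases h : i = k
    · subst h; simpa using measurable_snd
    · simpa [h] using measurable_fst.eval
  refine ⟨hm, (Measure.pi_eq fun s hs => ?_).symm⟩
  rw [Measure.map_apply hm (MeasurableSet.univ_pi hs)]
  -- The old `k`-th coordinate becomes unconstrained, and its factor has measure `1`.
  have : (fun p : (ι → α) × α => Function.update p.1 k p.2) ⁻¹' Set.univ.pi s
      = (Set.univ.pi (Function.update s k Set.univ)) ×ˢ s k := by
    ext p
    simp only [Set.mem_preimage, Set.mem_pi, Set.mem_univ, true_implies, Set.mem_prod]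
    constructor
    · intro h
      refine ⟨fun i => ?_, by simpa using h k⟩
      by_cases hi : i = k
      · subst hi; simp
      · simpa [hi] using h i
    · rintro ⟨h, h'⟩ i
      by_cases hi : i = k
      · subst hi; simpa using h'
      · simpa [hi] using h i
  rw [this, Measure.prod_prod, Measure.pi_pi, ← Finset.prod_erase_mul _ _ (Finset.mem_univ k),
    ← Finset.prod_erase_mul (s := Finset.univ) (fun i => ν (s i)) (Finset.mem_univ k)]
  simp only [Function.update_self, measure_univ, mul_one]
  congr 1
  refine Finset.prod_congr rfl fun i hi => ?_
  rw [Function.update_of_ne (Finset.ne_of_mem_erase hi)]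

theorem integral_eq_integral_update {f : (ι → α) → ℂ} (k : ι)
    (hf : Integrable f (Measure.pi fun _ : ι => ν)) :
    ∫ U, f U ∂(Measure.pi fun _ : ι => ν)
      = ∫ U, ∫ W, f (Function.update U k W) ∂ν ∂(Measure.pi fun _ : ι => ν) := by
  have h := measurePreserving_update ν k
  rw [← h.map_eq, integral_map h.measurable.aemeasurable
    (by rw [h.map_eq]; exact hf.aestronglyMeasurable), integral_prod]
  · rw [h.map_eq]
  · exact h.integrable_comp_of_integrable hf

end Update

/-! ### Haar moments of a gate and of an evolved local operator -/

section Twirling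

variable {q : ℕ}

/-- Matrices on the state space of two qudits. -/
abbrev PairMatrix (q : ℕ) : Type := Matrix (Fin q × Fin q) (Fin q × Fin q) ℂ

theorem integrable_haarGate {f : TwoQuditUnitary q → ℂ} (hf : Continuous f) :
    Integrable f (haarGate q) :=
  hf.integrable_of_hasCompactSupport (HasCompactSupport.of_compactSpace f)

theorem integral_haarGate_mul_right (f : TwoQuditUnitary q → ℂ) (W : TwoQuditUnitary q) :
    ∫ U, f (U * W) ∂haarGate q = ∫ U, f U ∂haarGate q :=
  integral_mul_right_eq_self f W

theorem integral_haarGate_mul_left (f : TwoQuditUnitary q → ℂ) (W : TwoQuditUnitary q) :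
    ∫ U, f (W * U) ∂haarGate q = ∫ U, f U ∂haarGate q :=
  integral_mul_left_eq_self f W

/-- The Haar average of a continuous family of linear maps on two-qudit matrices. -/
def haarAverage (Φ : TwoQuditUnitary q → PairMatrix q →ₗ[ℂ] PairMatrix q)
    (hΦ : ∀ X, Continuous fun U => Φ U X) : PairMatrix q →ₗ[ℂ] PairMatrix q where
  toFun X := Matrix.of fun i j => ∫ U, Φ U X i j ∂haarGate q
  map_add' X Y := by
    ext i j
    simp only [map_add, Matrix.add_apply, Matrix.of_apply]
    exact integral_add (integrable_haarGate ((hΦ X).matrix_elem i j))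
      (integrable_haarGate ((hΦ Y).matrix_elem i j))
  map_smul' c X := by
    ext i j
    simp only [map_smul, Matrix.smul_apply, Matrix.of_apply, smul_eq_mul, RingHom.id_apply]
    exact integral_const_mul _ _

theorem haarAverage_apply (Φ : TwoQuditUnitary q → PairMatrix q →ₗ[ℂ] PairMatrix q)
    (hΦ : ∀ X, Continuous fun U => Φ U X) (X : PairMatrix q) (i j : Fin q × Fin q) :
    haarAverage Φ hΦ X i j = ∫ U, Φ U X i j ∂haarGate q := rfl

theorem mul_haarAverage_mul (Φ : TwoQuditUnitary q → PairMatrix q →ₗ[ℂ] PairMatrix q)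
    (hΦ : ∀ X, Continuous fun U => Φ U X) (A B X : PairMatrix q) (i j : Fin q × Fin q) :
    (A * haarAverage Φ hΦ X * B) i j = ∫ U, (A * Φ U X * B) i j ∂haarGate q := by
  simp only [Matrix.mul_apply, haarAverage, LinearMap.coe_mk, AddHom.coe_mk, Matrix.of_apply]
  rw [integral_finsetSum]
  · refine Finset.sum_congr rfl fun k _ => ?_
    rw [integral_mul_const, integral_finsetSum]
    · simp only [integral_const_mul]
    · exact fun l _ => (integrable_haarGate ((hΦ X).matrix_elem l k)).const_mul _
  · refine fun k _ => Integrable.mul_const (integrable_finsetSum _ fun l _ => ?_) _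
    exact (integrable_haarGate ((hΦ X).matrix_elem l k)).const_mul _

theorem nontrivial_pair (hq : 2 ≤ q) : Nontrivial (Fin q × Fin q) := by
  have : Nontrivial (Fin q) := Fin.nontrivial_iff_two_le.mpr hq
  infer_instance

/-- The conjugation `X ↦ A X A†`. -/
def conjMap {d : Type*} [Fintype d] (A : Matrix d d ℂ) : Matrix d d ℂ →ₗ[ℂ] Matrix d d ℂ where
  toFun X := A * X * Aᴴ
  map_add' X Y := by rw [Matrix.mul_add, Matrix.add_mul]
  map_smul' c X := by simp

@[simp]
theorem conjMap_apply {d : Type*} [Fintype d] (A X : Matrix d d ℂ) :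
    conjMap A X = A * X * Aᴴ := rfl

theorem conjMap_mul {d : Type*} [Fintype d] (A B X : Matrix d d ℂ) :
    conjMap (A * B) X = conjMap A (conjMap B X) := by
  simp only [conjMap_apply, Matrix.conjTranspose_mul, Matrix.mul_assoc]

/-- Translates between moments of matrix entries and averaged conjugations evaluated on matrix
units. -/
theorem conjMap_single_apply {d : Type*} [Fintype d] [DecidableEq d] (A : Matrix d d ℂ)
    (i j k l : d) : conjMap A (Matrix.single l j 1) k i = star (A i j) * A k l := by
  simp [Matrix.mul_apply, Matrix.single_apply, ite_and, mul_comm]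

theorem continuous_coe_gate : Continuous fun U : TwoQuditUnitary q => (U : PairMatrix q) :=
  continuous_subtype_val

theorem continuous_conjMap_gate (X : PairMatrix q) :
    Continuous fun U : TwoQuditUnitary q => conjMap (U : PairMatrix q) X :=
  (continuous_coe_gate.matrix_mul continuous_const).matrix_mul
    continuous_coe_gate.matrix_conjTranspose

theorem trace_conjMap_of_mem_unitary {d : Type*} [Fintype d] [DecidableEq d] {A : Matrix d d ℂ}
    (hA : A ∈ Matrix.unitaryGroup d ℂ) (X : Matrix d d ℂ) : (conjMap A X).trace = X.trace := by
  have hA' : Aᴴ * A = 1 := Matrix.mem_unitaryGroup_iff'.mp hA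
  rw [conjMap_apply, Matrix.trace_mul_comm, ← Matrix.mul_assoc, hA', Matrix.one_mul]

theorem trace_haarAverage (Φ : TwoQuditUnitary q → PairMatrix q →ₗ[ℂ] PairMatrix q)
    (hΦ : ∀ X, Continuous fun U => Φ U X) (X : PairMatrix q) :
    (haarAverage Φ hΦ X).trace = ∫ U, (Φ U X).trace ∂haarGate q := by
  simp only [Matrix.trace, Matrix.diag_apply]
  rw [integral_finsetSum _ fun k _ => integrable_haarGate ((hΦ X).matrix_elem k k)]
  rfl

/-- First moments of the Haar measure. -/
theorem integral_star_mul_gate (hq : 2 ≤ q) (i j k l : Fin q × Fin q) :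
    ∫ U : TwoQuditUnitary q, star ((U : PairMatrix q) i j) * (U : PairMatrix q) k l ∂haarGate q
      = (1 / (q : ℂ) ^ 2) * if k = i ∧ l = j then 1 else 0 := by
  have := nontrivial_pair hq
  have hq0 : (q : ℂ) ≠ 0 := by exact_mod_cast (by omega : q ≠ 0)
  set T := haarAverage (fun U : TwoQuditUnitary q => conjMap (U : PairMatrix q))
    continuous_conjMap_gate with hTdef
  -- Right invariance makes `T` blind to conjugation of its argument, which kills the coefficient
  -- `a`; left invariance makes each `T X` commute with all unitaries. Together they give
  -- covariance.
  have hr : ∀ W ∈ Matrix.unitaryGroup (Fin q × Fin q) ℂ, ∀ X, T (conjMap W X) = T X := by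
    intro W hW X
    ext i j
    rw [hTdef, haarAverage_apply, haarAverage_apply, ← integral_haarGate_mul_right
      (fun U : TwoQuditUnitary q => conjMap (U : PairMatrix q) X i j) ⟨W, hW⟩]
    simp only [← conjMap_mul, Submonoid.coe_mul]
  obtain ⟨a, b, hab⟩ := exists_eq_smul_add_trace_smul T (by
    intro W hW X
    refine (hr W hW X).trans ?_
    ext i j
    rw [mul_haarAverage_mul, haarAverage_apply, ← integral_haarGate_mul_left
      (fun U : TwoQuditUnitary q => conjMap (U : PairMatrix q) X i j) ⟨W, hW⟩]
    simp only [← conjMap_apply W, ← conjMap_mul, Submonoid.coe_mul])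
  obtain ⟨p, r, hpr⟩ := exists_pair_ne (Fin q × Fin q)
  have ha : a = 0 := by
    have h := hr _ (swap_permMatrix_mem_unitary p r) (Matrix.single p p 1)
    rw [hab, hab, trace_conjMap_of_mem_unitary (swap_permMatrix_mem_unitary p r)] at h
    have h2 : a • conjMap ((Equiv.swap p r).permMatrix ℂ) (Matrix.single p p 1)
        = a • Matrix.single p p 1 := add_left_injective _ h
    have h' := congrFun (congrFun h2.symm p) p
    simpa [Matrix.mul_apply, Matrix.single_apply, Equiv.Perm.permMatrix, PEquiv.toMatrix_apply,
      ite_and, hpr, hpr.symm] using h'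
  have hb : b * (q : ℂ) ^ 2 = 1 := by
    have h : (T (Matrix.single p p 1)).trace = 1 := by
      rw [hTdef, trace_haarAverage]
      simp only [trace_conjMap_of_mem_unitary (SetLike.coe_mem _)]
      simp
    rw [hab, ha] at h
    simpa [pow_two] using h
  have h := congrFun (congrFun (hab (Matrix.single l j 1)) k) i
  have hb' : b = 1 / (q : ℂ) ^ 2 := by field_simp; exact hb
  simp only [← conjMap_single_apply]
  refine h.trans ?_
  rw [ha, hb']
  by_cases h1 : k = i <;> by_cases h2 : l = j <;> simp [h1, h2, Matrix.trace_single_eq_of_ne]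

/-- A local operator on the second qudit of a pair, evolved in the Heisenberg picture. -/
def evolvedUnit (ab : Fin q × Fin q) (U : TwoQuditUnitary q) : PairMatrix q :=
  (U : PairMatrix q)ᴴ * Matrix.kronecker 1 (Matrix.single ab.1 ab.2 1) * (U : PairMatrix q)

theorem continuous_evolvedUnit (ab : Fin q × Fin q) :
    Continuous (evolvedUnit ab : TwoQuditUnitary q → PairMatrix q) :=
  (continuous_coe_gate.matrix_conjTranspose.matrix_mul continuous_const).matrix_mul
    continuous_coe_gate

/-- Each summand is `1 ⊗ E_bb`, and every `b` occurs `q` times. -/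
theorem sum_conjTranspose_kronecker_mul :
    ∑ ab : Fin q × Fin q, (Matrix.kronecker (1 : Matrix (Fin q) (Fin q) ℂ)
        (Matrix.single ab.1 ab.2 (1 : ℂ)))ᴴ * Matrix.kronecker 1 (Matrix.single ab.1 ab.2 1)
      = (q : ℂ) • (1 : PairMatrix q) := by
  have h : ∀ ab : Fin q × Fin q, (Matrix.kronecker (1 : Matrix (Fin q) (Fin q) ℂ)
        (Matrix.single ab.1 ab.2 (1 : ℂ)))ᴴ * Matrix.kronecker 1 (Matrix.single ab.1 ab.2 1)
      = Matrix.kronecker 1 (Matrix.single ab.2 ab.2 1) := by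
    intro ab
    rw [Matrix.kronecker, Matrix.conjTranspose_kronecker, ← Matrix.mul_kronecker_mul]
    simp
  simp only [h]
  ext ⟨i, i'⟩ ⟨j, j'⟩
  simp only [Matrix.sum_apply, Matrix.kronecker, Matrix.kroneckerMap_apply, Fintype.sum_prod_type,
    Matrix.smul_apply, Matrix.one_apply, Matrix.single_apply, Prod.mk.injEq]
  by_cases h1 : i = j <;> by_cases h2 : i' = j' <;> simp [h1, h2, ite_and]

theorem sum_conjTranspose_evolvedUnit_mul (U : TwoQuditUnitary q) :
    ∑ ab, (evolvedUnit ab U)ᴴ * evolvedUnit ab U = (q : ℂ) • (1 : PairMatrix q) := by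
  have h1 : (U : PairMatrix q) * (U : PairMatrix q)ᴴ = 1 := Matrix.mem_unitaryGroup_iff.mp U.2
  have h2 : (U : PairMatrix q)ᴴ * (U : PairMatrix q) = 1 := Matrix.mem_unitaryGroup_iff'.mp U.2
  have : ∀ ab, (evolvedUnit ab U)ᴴ * evolvedUnit ab U = (U : PairMatrix q)ᴴ *
      ((Matrix.kronecker (1 : Matrix (Fin q) (Fin q) ℂ) (Matrix.single ab.1 ab.2 (1 : ℂ)))ᴴ *
        Matrix.kronecker 1 (Matrix.single ab.1 ab.2 1)) * (U : PairMatrix q) := by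
    intro ab
    simp only [evolvedUnit, Matrix.conjTranspose_mul, Matrix.conjTranspose_conjTranspose,
      Matrix.mul_assoc]
    rw [← Matrix.mul_assoc (U : PairMatrix q) _ _, h1, Matrix.one_mul]
  simp only [this]
  rw [← Finset.sum_mul, ← Finset.mul_sum, sum_conjTranspose_kronecker_mul]
  simp [h2]

theorem trace_evolvedUnit (ab : Fin q × Fin q) (U : TwoQuditUnitary q) :
    (evolvedUnit ab U).trace = if ab.1 = ab.2 then (q : ℂ) else 0 := by
  have h1 : (U : PairMatrix q) * (U : PairMatrix q)ᴴ = 1 := Matrix.mem_unitaryGroup_iff.mp U.2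
  rw [evolvedUnit, Matrix.trace_mul_comm, ← Matrix.mul_assoc, h1, Matrix.one_mul,
    Matrix.kronecker, Matrix.trace_kronecker]
  by_cases h : ab.1 = ab.2 <;> simp [h, Matrix.trace_single_eq_of_ne]

/-- The Heisenberg-evolved partial trace channel. -/
def evolvedMap (U : TwoQuditUnitary q) : PairMatrix q →ₗ[ℂ] PairMatrix q :=
  ∑ ab, conjMap (evolvedUnit ab U)

theorem evolvedMap_apply (U : TwoQuditUnitary q) (X : PairMatrix q) :
    evolvedMap U X = ∑ ab, conjMap (evolvedUnit ab U) X := by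
  simp only [evolvedMap, LinearMap.sum_apply]

theorem continuous_evolvedMap (X : PairMatrix q) :
    Continuous fun U : TwoQuditUnitary q => evolvedMap U X := by
  simp only [evolvedMap_apply, conjMap_apply]
  exact continuous_finsetSum _ fun ab _ =>
    ((continuous_evolvedUnit ab).matrix_mul continuous_const).matrix_mul
      (continuous_evolvedUnit ab).matrix_conjTranspose

/-- Replacing `U` by `U * W` conjugates every evolved unit by `W†`. After averaging, right
invariance turns this identity into covariance. -/
theorem evolvedMap_conjMap (U W : TwoQuditUnitary q) (X : PairMatrix q) :
    evolvedMap U (conjMap (W : PairMatrix q) X)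
      = conjMap (W : PairMatrix q) (evolvedMap (U * W) X) := by
  have h1 : (W : PairMatrix q) * (W : PairMatrix q)ᴴ = 1 := Matrix.mem_unitaryGroup_iff.mp W.2
  simp only [evolvedMap_apply, map_sum, ← conjMap_mul]
  refine Finset.sum_congr rfl fun ab _ => ?_
  congr 2
  have hc : ((U * W : TwoQuditUnitary q) : PairMatrix q) = (U : PairMatrix q) * (W : PairMatrix q) :=
    rfl
  simp only [evolvedUnit, hc, Matrix.conjTranspose_mul]
  simp only [← Matrix.mul_assoc, h1, Matrix.one_mul]

theorem trace_evolvedMap (U : TwoQuditUnitary q) (X : PairMatrix q) :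
    (evolvedMap U X).trace = q * X.trace := by
  simp only [evolvedMap_apply, conjMap_apply, Matrix.trace_sum]
  have : ∀ ab, (evolvedUnit ab U * X * (evolvedUnit ab U)ᴴ).trace
      = (((evolvedUnit ab U)ᴴ * evolvedUnit ab U) * X).trace := by
    intro ab
    rw [Matrix.trace_mul_comm, Matrix.mul_assoc]
  simp only [this]
  rw [← Matrix.trace_sum, ← Finset.sum_mul, sum_conjTranspose_evolvedUnit_mul]
  simp

/-- This trace of the map as an operator on matrices equals `∑ |tr M_ab|²`; the `q` diagonal units
contribute `q²` each, the others nothing. -/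
theorem sum_evolvedMap_single (U : TwoQuditUnitary q) :
    ∑ k, ∑ l, evolvedMap U (Matrix.single k l 1) k l = (q : ℂ) ^ 3 := by
  have : ∀ k l, evolvedMap U (Matrix.single k l 1) k l
      = ∑ ab, star (evolvedUnit ab U l l) * evolvedUnit ab U k k := by
    intro k l
    rw [evolvedMap_apply, Matrix.sum_apply]
    exact Finset.sum_congr rfl fun ab _ => conjMap_single_apply _ _ _ _ _
  simp only [this]
  calc _ = ∑ ab, star (evolvedUnit ab U).trace * (evolvedUnit ab U).trace := by
        simp only [Matrix.trace, Matrix.diag_apply, star_sum, Finset.sum_mul_sum]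
        rw [Finset.sum_comm]
        conv_lhs => enter [2, l]; rw [Finset.sum_comm]
        rw [Finset.sum_comm]
    _ = _ := by
        simp only [trace_evolvedUnit, Fintype.sum_prod_type]
        simp [pow_succ, mul_assoc]

/-- Second moments of the Haar measure, as needed for a Heisenberg-evolved local operator. -/
theorem integral_sum_star_mul_evolvedUnit (hq : 2 ≤ q) (i j k l : Fin q × Fin q) :
    ∫ U : TwoQuditUnitary q, ∑ ab, star (evolvedUnit ab U i j) * evolvedUnit ab U k l ∂haarGate q
      = ((q : ℂ) / (q ^ 2 + 1)) * ((if i = j ∧ k = l then 1 else 0)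
        + if k = i ∧ l = j then 1 else 0) := by
  have := nontrivial_pair hq
  have hq0 : (q : ℂ) ≠ 0 := by exact_mod_cast (by omega : q ≠ 0)
  have hq1 : (q : ℂ) ^ 2 + 1 ≠ 0 := by exact_mod_cast (by positivity : q ^ 2 + 1 ≠ 0)
  have hq2 : (q : ℂ) ^ 2 - 1 ≠ 0 := by
    rw [sub_ne_zero]
    exact_mod_cast (by nlinarith : q ^ 2 ≠ 1)
  set T := haarAverage (evolvedMap (q := q)) continuous_evolvedMap with hTdef
  obtain ⟨a, b, hab⟩ := exists_eq_smul_add_trace_smul T (by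
    intro W hW X
    ext i j
    rw [mul_haarAverage_mul]
    refine Eq.trans ?_ (integral_haarGate_mul_right
      (fun U => conjMap W (evolvedMap U X) i j) ⟨W, hW⟩)
    refine integral_congr_ae (ae_of_all _ fun U => ?_)
    exact congrFun (congrFun (evolvedMap_conjMap U ⟨W, hW⟩ X) i) j)
  obtain ⟨p, r, hpr⟩ := exists_pair_ne (Fin q × Fin q)
  -- Two linear equations for `a` and `b`: `h1` from the trace of an image, `h2` from the trace of
  -- the map itself.
  have h1 : a + b * (q : ℂ) ^ 2 = q := by
    have h : (T (Matrix.single p p 1)).trace = q := by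
      rw [hTdef, trace_haarAverage]
      simp only [trace_evolvedMap]
      simp
    rw [hab] at h
    simpa [pow_two] using h
  have h2 : a * (q : ℂ) ^ 4 + b * (q : ℂ) ^ 2 = (q : ℂ) ^ 3 := by
    have h : ∑ k, ∑ l, T (Matrix.single k l 1) k l = (q : ℂ) ^ 3 := by
      have hi : ∀ k l, Integrable (fun U => evolvedMap U (Matrix.single k l 1) k l) (haarGate q) :=
        fun k l => integrable_haarGate ((continuous_evolvedMap _).matrix_elem k l)
      calc _ = ∫ U, ∑ k, ∑ l, evolvedMap U (Matrix.single k l 1) k l ∂haarGate q := by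
            rw [integral_finsetSum _ fun k _ => integrable_finsetSum _ fun l _ => hi k l]
            refine Finset.sum_congr rfl fun k _ => ?_
            rw [integral_finsetSum _ fun l _ => hi k l]
            rfl
        _ = _ := by simp [sum_evolvedMap_single]
    have e : ∀ k l, T (Matrix.single k l 1) k l = a + b * if k = l then 1 else 0 := by
      intro k l
      rw [hab]
      by_cases h : k = l <;> simp [h]
    simp only [e, Finset.sum_add_distrib, ← Finset.mul_sum] at h
    simp at h
    linear_combination h
  -- `h2 - h1` reads `a (q⁴ - 1) = q (q² - 1)`; cancel `q² - 1`.
  have ha : a = (q : ℂ) / (q ^ 2 + 1) := by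
    rw [eq_div_iff hq1]
    apply mul_left_cancel₀ hq2
    linear_combination h2 - h1
  have hb : b = (q : ℂ) / (q ^ 2 + 1) := by
    rw [ha] at h1
    field_simp at h1 ⊢
    apply mul_left_cancel₀ hq0
    linear_combination h1
  have h := congrFun (congrFun (hab (Matrix.single l j 1)) k) i
  have hc : ∀ U : TwoQuditUnitary q, ∑ ab, star (evolvedUnit ab U i j) * evolvedUnit ab U k l
      = evolvedMap U (Matrix.single l j 1) k i := by
    intro U
    rw [evolvedMap_apply, Matrix.sum_apply]
    exact Finset.sum_congr rfl fun ab _ => (conjMap_single_apply _ _ _ _ _).symm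
  simp only [hc]
  refine h.trans ?_
  rw [ha, hb]
  have htr : (Matrix.single l j (1 : ℂ)).trace = if l = j then 1 else 0 := by
    split_ifs with h
    · simp [h]
    · exact Matrix.trace_single_eq_of_ne _ _ _ h
  have hs : Matrix.single l j (1 : ℂ) k i = if i = j ∧ k = l then 1 else 0 := by
    rw [Matrix.single_apply]
    exact if_congr ⟨fun h => ⟨h.2.symm, h.1.symm⟩, fun h => ⟨h.2.symm, h.1.symm⟩⟩ rfl rfl
  rw [Matrix.add_apply, Matrix.smul_apply, Matrix.smul_apply, smul_eq_mul, smul_eq_mul,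
    hs, htr, Matrix.one_apply, mul_add, mul_assoc]
  congr 2
  by_cases h1 : k = i <;> by_cases h2 : l = j <;> simp [h1, h2]

end Twirling

/-! ### Averages of quadratic forms -/

section Moments

variable {q : ℕ} {D : Type*} [Fintype D]

/-- The diagonal matrix element at `z` of `A† P A`. -/
def quadForm (P : Matrix D D ℂ) (z : D) (A : Matrix D D ℂ) : ℂ := (Aᴴ * P * A) z z

theorem quadForm_expand (P : Matrix D D ℂ) (z : D) (L : PairMatrix q →ₗ[ℂ] Matrix D D ℂ)
    (M : PairMatrix q) :
    quadForm P z (L M) = ∑ p : (Fin q × Fin q) × (Fin q × Fin q),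
      ∑ r : (Fin q × Fin q) × (Fin q × Fin q), star (M p.1 p.2) * M r.1 r.2 *
        ((L (Matrix.single p.1 p.2 1))ᴴ * P * L (Matrix.single r.1 r.2 1)) z z := by
  have h : L M = ∑ p : (Fin q × Fin q) × (Fin q × Fin q),
      M p.1 p.2 • L (Matrix.single p.1 p.2 1) := by
    conv_lhs => rw [Matrix.matrix_eq_sum_single M]
    simp only [Fintype.sum_prod_type, map_sum]
    simp only [← map_smul, Matrix.smul_single, smul_eq_mul, mul_one]
  rw [quadForm, h, Matrix.conjTranspose_sum, Finset.sum_mul, Finset.sum_mul, Matrix.sum_apply]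
  refine Finset.sum_congr rfl fun p _ => ?_
  rw [Finset.mul_sum, Matrix.sum_apply]
  refine Finset.sum_congr rfl fun r _ => ?_
  rw [Matrix.conjTranspose_smul, Matrix.smul_mul, Matrix.smul_mul, Matrix.mul_smul, smul_smul,
    Matrix.smul_apply, smul_eq_mul]

theorem continuous_quadForm {E : Type*} [TopologicalSpace E] (P : Matrix D D ℂ) (z : D)
    {A : E → Matrix D D ℂ} (hA : Continuous A) : Continuous fun e => quadForm P z (A e) :=
  ((hA.matrix_conjTranspose.matrix_mul continuous_const).matrix_mul hA).matrix_elem z z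

theorem integral_quadForm_gate (hq : 2 ≤ q) (P : Matrix D D ℂ) (z : D)
    (L : PairMatrix q →ₗ[ℂ] Matrix D D ℂ) :
    ∫ U : TwoQuditUnitary q, quadForm P z (L U) ∂haarGate q
      = 1 / (q : ℂ) ^ 2 * ∑ p : (Fin q × Fin q) × (Fin q × Fin q),
        quadForm P z (L (Matrix.single p.1 p.2 1)) := by
  have hi : ∀ p r : (Fin q × Fin q) × (Fin q × Fin q), ∀ c : ℂ,
      Integrable (fun U : TwoQuditUnitary q =>
        star ((U : PairMatrix q) p.1 p.2) * (U : PairMatrix q) r.1 r.2 * c) (haarGate q) :=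
    fun p r c => integrable_haarGate (((continuous_coe_gate.matrix_elem _ _).star.mul
      (continuous_coe_gate.matrix_elem _ _)).mul_const c)
  have hs : ∀ U : TwoQuditUnitary q, quadForm P z (L U) = _ := fun U => quadForm_expand P z L U
  simp only [hs]
  rw [integral_finsetSum _ fun p _ => integrable_finsetSum _ fun r _ => hi p r _,
    Finset.mul_sum]
  refine Finset.sum_congr rfl fun p _ => ?_
  rw [integral_finsetSum _ fun r _ => hi p r _]
  simp only [integral_mul_const, integral_star_mul_gate hq]
  rw [Finset.sum_eq_single p]
  · simp [quadForm]
  · intro r _ hr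
    rw [if_neg fun h => hr (Prod.ext h.1 h.2)]
    simp
  · simp

theorem integral_quadForm_evolvedUnit (hq : 2 ≤ q) (P : Matrix D D ℂ) (z : D)
    (L : PairMatrix q →ₗ[ℂ] Matrix D D ℂ) :
    ∫ U : TwoQuditUnitary q, ∑ ab, quadForm P z (L (evolvedUnit ab U)) ∂haarGate q
      = (q : ℂ) / (q ^ 2 + 1) * (quadForm P z (L 1) +
        ∑ p : (Fin q × Fin q) × (Fin q × Fin q), quadForm P z (L (Matrix.single p.1 p.2 1))) := by
  have hi : ∀ p r : (Fin q × Fin q) × (Fin q × Fin q), ∀ c : ℂ,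
      Integrable (fun U : TwoQuditUnitary q =>
        (∑ ab, star (evolvedUnit ab U p.1 p.2) * evolvedUnit ab U r.1 r.2) * c) (haarGate q) :=
    fun p r c => integrable_haarGate ((continuous_finsetSum _ fun ab _ =>
      ((continuous_evolvedUnit ab).matrix_elem _ _).star.mul
      ((continuous_evolvedUnit ab).matrix_elem _ _)).mul_const c)
  have hs : ∀ U : TwoQuditUnitary q, ∑ ab, quadForm P z (L (evolvedUnit ab U))
      = ∑ p : (Fin q × Fin q) × (Fin q × Fin q), ∑ r : (Fin q × Fin q) × (Fin q × Fin q),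
        (∑ ab, star (evolvedUnit ab U p.1 p.2) * evolvedUnit ab U r.1 r.2) *
        ((L (Matrix.single p.1 p.2 1))ᴴ * P * L (Matrix.single r.1 r.2 1)) z z := by
    intro U
    simp only [quadForm_expand P z L, Finset.sum_mul]
    rw [Finset.sum_comm]
    exact Finset.sum_congr rfl fun p _ => Finset.sum_comm
  simp only [hs]
  rw [integral_finsetSum _ fun p _ => integrable_finsetSum _ fun r _ => hi p r _,
    quadForm_expand P z L 1, ← Finset.sum_add_distrib, Finset.mul_sum]
  refine Finset.sum_congr rfl fun p _ => ?_
  rw [integral_finsetSum _ fun r _ => hi p r _]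
  simp only [integral_mul_const, integral_sum_star_mul_evolvedUnit hq, mul_add, add_mul,
    Finset.sum_add_distrib]
  -- The pairing `i = j`, `k = l` reassembles the form at `L 1`; the other one keeps only the
  -- diagonal terms `r = p`.
  congr 1
  · rw [Finset.mul_sum]
    refine Finset.sum_congr rfl fun r _ => ?_
    by_cases h1 : p.1 = p.2 <;> by_cases h2 : r.1 = r.2 <;> simp [Matrix.one_apply, h1, h2]
  · rw [Finset.sum_eq_single p]
    · simp [quadForm]
    · intro r _ hr
      rw [if_neg fun h => hr (Prod.ext h.1 h.2)]
      simp
    · simp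

/-- Moving each `(e a)ᴴ` past `P` brings `∑ (e a)ᴴ * e a` together. Used to sum out the units on the
newest site. -/
theorem sum_quadForm_mul {κ : Type*} [Fintype κ] [DecidableEq D] {P : Matrix D D ℂ} (z : D)
    {e : κ → Matrix D D ℂ} {c : ℂ} (he : ∑ a, (e a)ᴴ * e a = c • 1)
    (hP : ∀ a, Commute (e a)ᴴ P) (A : Matrix D D ℂ) :
    ∑ a, quadForm P z (e a * A) = c * quadForm P z A := by
  have h : ∀ a, (e a * A)ᴴ * P * (e a * A) = Aᴴ * P * ((e a)ᴴ * e a) * A := by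
    intro a
    rw [Matrix.conjTranspose_mul, Matrix.mul_assoc Aᴴ, (hP a).eq]
    simp only [Matrix.mul_assoc]
  simp only [quadForm, h]
  rw [← Matrix.sum_apply, ← Finset.sum_mul, ← Finset.mul_sum, he]
  simp

end Moments

/-! ### Operators supported on one or two sites -/

section LocalOperators

variable {n q : ℕ}

/-- An operator on the sites `i, j`, tensored with the identity on the other sites. -/
def pairOp (i j : Fin n) : PairMatrix q →ₗ[ℂ] Matrix (Config n q) (Config n q) ℂ where
  toFun M := Matrix.of fun x y =>
    if ∀ k, k ≠ i → k ≠ j → x k = y k then M (x i, x j) (y i, y j) else 0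
  map_add' M N := by
    ext x y
    simp only [Matrix.of_apply, Matrix.add_apply]
    split_ifs <;> simp
  map_smul' c M := by
    ext x y
    simp

theorem pairOp_apply (i j : Fin n) (M : PairMatrix q) (x y : Config n q) :
    pairOp i j M x y = if ∀ k, k ≠ i → k ≠ j → x k = y k then M (x i, x j) (y i, y j) else 0 :=
  rfl

theorem sum_ite_agree {i j : Fin n} (hij : i ≠ j) (y : Config n q) (f : Config n q → ℂ) :
    (∑ z : Config n q, if ∀ k, k ≠ i → k ≠ j → z k = y k then f z else 0)
      = ∑ p : Fin q × Fin q, f (Function.update (Function.update y i p.1) j p.2) := by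
  rw [← Finset.sum_filter]
  refine Finset.sum_bij' (fun z _ => (z i, z j))
    (fun p _ => Function.update (Function.update y i p.1) j p.2) (by simp) ?_ ?_ ?_ ?_
  · intro p _
    simp only [Finset.mem_filter, Finset.mem_univ, true_and]
    intro k h1 h2
    simp [h1, h2]
  · intro z hz
    simp only [Finset.mem_filter, Finset.mem_univ, true_and] at hz
    ext k
    by_cases h2 : k = j
    · subst h2; simp
    · by_cases h1 : k = i
      · subst h1; simp [h2]
      · simp [h1, h2, hz k h1 h2]
  · intro p _
    simp [hij]
  · intro z hz
    simp only [Finset.mem_filter, Finset.mem_univ, true_and] at hz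
    congr 1
    ext k
    by_cases h2 : k = j
    · subst h2; simp
    · by_cases h1 : k = i
      · subst h1; simp [h2]
      · simp [h1, h2, hz k h1 h2]

theorem pairOp_mul {i j : Fin n} (hij : i ≠ j) (M N : PairMatrix q) :
    pairOp i j (M * N) = pairOp i j M * pairOp i j N := by
  ext x y
  rw [Matrix.mul_apply]
  simp only [pairOp_apply]
  have h : ∀ z : Config n q,
      (if ∀ k, k ≠ i → k ≠ j → x k = z k then M (x i, x j) (z i, z j) else 0) *
        (if ∀ k, k ≠ i → k ≠ j → z k = y k then N (z i, z j) (y i, y j) else 0)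
      = if ∀ k, k ≠ i → k ≠ j → z k = y k then
          (if ∀ k, k ≠ i → k ≠ j → x k = z k then M (x i, x j) (z i, z j) else 0) *
            N (z i, z j) (y i, y j) else 0 := by
    intro z
    rw [mul_ite, mul_zero]
  simp only [h]
  rw [sum_ite_agree hij, Matrix.mul_apply]
  have h2 : ∀ p : Fin q × Fin q, (∀ k, k ≠ i → k ≠ j →
      x k = Function.update (Function.update y i p.1) j p.2 k) ↔
      ∀ k, k ≠ i → k ≠ j → x k = y k := by
    intro p
    refine forall_congr' fun k => forall_congr' fun h1 => forall_congr' fun h2 => ?_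
    simp [h1, h2]
  simp only [h2]
  split_ifs
  · refine Finset.sum_congr rfl fun p _ => ?_
    simp [hij]
  · simp

theorem pairOp_one {i j : Fin n} : pairOp i j (1 : PairMatrix q) = 1 := by
  ext x y
  rw [pairOp_apply, Matrix.one_apply, Matrix.one_apply]
  by_cases h : x = y
  · subst h; simp
  · rw [if_neg h]
    split_ifs with h1 h2
    · refine absurd (funext fun k => ?_) h
      rw [Prod.mk.injEq] at h2
      by_cases hi : k = i
      · exact hi ▸ h2.1
      · by_cases hj : k = j
        · exact hj ▸ h2.2
        · exact h1 k hi hj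
    · rfl
    · rfl

theorem pairOp_conjTranspose {i j : Fin n} (M : PairMatrix q) :
    pairOp i j Mᴴ = (pairOp i j M)ᴴ := by
  ext x y
  rw [Matrix.conjTranspose_apply, pairOp_apply, pairOp_apply, Matrix.conjTranspose_apply]
  by_cases h : ∀ k, k ≠ i → k ≠ j → x k = y k
  · rw [if_pos h, if_pos fun k h1 h2 => (h k h1 h2).symm]
  · rw [if_neg h, if_neg fun h' => h fun k h1 h2 => (h' k h1 h2).symm, star_zero]

/-- The matrix unit `|a⟩⟨b|` on the site `s`, tensored with the identity on the other sites. -/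
def siteUnit (s : Fin n) (ab : Fin q × Fin q) : Matrix (Config n q) (Config n q) ℂ :=
  Matrix.of fun x y => if (∀ k, k ≠ s → x k = y k) ∧ x s = ab.1 ∧ y s = ab.2 then 1 else 0

theorem siteUnit_apply (s : Fin n) (ab : Fin q × Fin q) (x y : Config n q) :
    siteUnit s ab x y = if (∀ k, k ≠ s → x k = y k) ∧ x s = ab.1 ∧ y s = ab.2 then 1 else 0 := rfl

theorem siteUnit_conjTranspose (s : Fin n) (ab : Fin q × Fin q) :
    (siteUnit s ab)ᴴ = siteUnit s ab.swap := by
  ext x y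
  rw [Matrix.conjTranspose_apply, siteUnit_apply, siteUnit_apply, apply_ite star, star_one,
    star_zero]
  refine if_congr ⟨?_, ?_⟩ rfl rfl <;>
  · rintro ⟨h, h1, h2⟩
    exact ⟨fun k hk => (h k hk).symm, h2, h1⟩

theorem pairOp_kronecker_one {i j : Fin n} (hij : i ≠ j) (ab : Fin q × Fin q) :
    pairOp i j (Matrix.kronecker (Matrix.single ab.1 ab.2 1) 1) = siteUnit i ab := by
  ext x y
  rw [pairOp_apply, siteUnit_apply]
  simp only [Matrix.kronecker, Matrix.kroneckerMap_apply, Matrix.single_apply, Matrix.one_apply,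
    mul_ite, mul_one, mul_zero, ← ite_and]
  refine if_congr ⟨?_, ?_⟩ rfl rfl
  · rintro ⟨h1, h2, h3, h4⟩
    refine ⟨fun k hk => ?_, h3.symm, h4.symm⟩
    by_cases hj : k = j
    · exact hj ▸ h2
    · exact h1 k hk hj
  · rintro ⟨h1, h2, h3⟩
    exact ⟨fun k hk _ => h1 k hk, h1 j hij.symm, h2.symm, h3.symm⟩

theorem pairOp_one_kronecker {i j : Fin n} (hij : i ≠ j) (ab : Fin q × Fin q) :
    pairOp i j (Matrix.kronecker 1 (Matrix.single ab.1 ab.2 1)) = siteUnit j ab := by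
  ext x y
  rw [pairOp_apply, siteUnit_apply]
  simp only [Matrix.kronecker, Matrix.kroneckerMap_apply, Matrix.single_apply, Matrix.one_apply,
    mul_ite, mul_one, mul_zero, ← ite_and]
  refine if_congr ⟨?_, ?_⟩ rfl rfl
  · rintro ⟨h1, ⟨h3, h4⟩, h2⟩
    refine ⟨fun k hk => ?_, h3.symm, h4.symm⟩
    by_cases hi : k = i
    · exact hi ▸ h2
    · exact h1 k hi hk
  · rintro ⟨h1, h2, h3⟩
    exact ⟨fun k _ hk => h1 k hk, ⟨h2.symm, h3.symm⟩, h1 i hij⟩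

/-- A matrix unit of a pair is a product of one-site units, so the two sites can be summed
separately. -/
theorem pairOp_single {i j : Fin n} (hij : i ≠ j) (p : (Fin q × Fin q) × (Fin q × Fin q)) :
    pairOp i j (Matrix.single p.1 p.2 1)
      = siteUnit j (p.1.2, p.2.2) * siteUnit i (p.1.1, p.2.1) := by
  have h : Matrix.single p.1 p.2 (1 : ℂ)
      = Matrix.kronecker 1 (Matrix.single p.1.2 p.2.2 1) *
        Matrix.kronecker (Matrix.single p.1.1 p.2.1 1) 1 := by
    refine Eq.trans ?_ (Matrix.mul_kronecker_mul 1 (Matrix.single p.1.1 p.2.1 (1 : ℂ))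
      (Matrix.single p.1.2 p.2.2 (1 : ℂ)) 1)
    rw [Matrix.one_mul, Matrix.mul_one, Matrix.single_kronecker_single, one_mul]
  rw [h, pairOp_mul hij, ← pairOp_kronecker_one hij, ← pairOp_one_kronecker hij]

theorem sum_siteUnit (i j : Fin n) (hij : i ≠ j) :
    ∑ ab : Fin q × Fin q, (siteUnit j ab)ᴴ * siteUnit j ab
      = (q : ℂ) • (1 : Matrix (Config n q) (Config n q) ℂ) := by
  simp only [← pairOp_one_kronecker hij, ← pairOp_conjTranspose, ← pairOp_mul hij]
  rw [← map_sum, sum_conjTranspose_kronecker_mul, map_smul, pairOp_one]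

theorem commute_siteUnit_pairOp {s i j : Fin n} (hi : s ≠ i) (hj : s ≠ j) (ab : Fin q × Fin q)
    (M : PairMatrix q) : Commute (siteUnit s ab) (pairOp i j M) := by
  ext x y
  -- The unit at `s` leaves one possible intermediate configuration in each product.
  rw [Matrix.mul_apply, Matrix.mul_apply, Finset.sum_eq_single (Function.update x s ab.2),
    Finset.sum_eq_single (Function.update y s ab.1)]
  · rw [siteUnit_apply, siteUnit_apply, pairOp_apply, pairOp_apply]
    have h3 : (∀ k, k ≠ i → k ≠ j → Function.update x s ab.2 k = y k) ∧ x s = ab.1 ↔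
        (∀ k, k ≠ i → k ≠ j → x k = Function.update y s ab.1 k) ∧ y s = ab.2 := by
      constructor
      · rintro ⟨h, hs⟩
        refine ⟨fun k hki hkj => ?_, by simpa using (h s hi hj).symm⟩
        by_cases hk : k = s
        · subst hk; simpa using hs
        · simpa [hk] using h k hki hkj
      · rintro ⟨h, hs⟩
        refine ⟨fun k hki hkj => ?_, by simpa using h s hi hj⟩
        by_cases hk : k = s
        · subst hk; simpa using hs.symm
        · simpa [hk] using h k hki hkj
    simp only [Function.update_self, and_true, ite_mul, mul_ite,
      one_mul, mul_one, zero_mul, mul_zero, ← ite_and, Function.update_of_ne hi.symm,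
      Function.update_of_ne hj.symm]
    refine if_congr ⟨?_, ?_⟩ rfl rfl
    · rintro ⟨hb, -, ha⟩
      exact ⟨⟨fun k hk => by simp [hk], trivial, (h3.1 ⟨hb, ha⟩).2⟩, (h3.1 ⟨hb, ha⟩).1⟩
    · rintro ⟨⟨-, -, ha⟩, hb⟩
      exact ⟨(h3.2 ⟨hb, ha⟩).1, fun k hk => by simp [hk], (h3.2 ⟨hb, ha⟩).2⟩
  · intro z _ hz
    rw [siteUnit_apply, if_neg, mul_zero]
    rintro ⟨h1, h2, -⟩
    refine hz (funext fun k => ?_)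
    by_cases hk : k = s
    · subst hk; simp [h2]
    · simp [hk, h1 k hk]
  · simp
  · intro z _ hz
    rw [siteUnit_apply, if_neg, zero_mul]
    rintro ⟨h1, -, h2⟩
    refine hz (funext fun k => ?_)
    by_cases hk : k = s
    · subst hk; simp [h2]
    · simp [hk, h1 k hk]
  · simp

theorem commute_siteUnit_zeroProj [NeZero q] {s t : Fin n} (h : s ≠ t) (ab : Fin q × Fin q) :
    Commute (siteUnit s ab) (zeroProj t) := by
  ext x y
  rw [zeroProj, Matrix.mul_diagonal, Matrix.diagonal_mul, siteUnit_apply]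
  by_cases h1 : ∀ k, k ≠ s → x k = y k
  · rw [h1 t h.symm, mul_comm]
  · simp [h1]

end LocalOperators

/-! ### The convolutional circuit and its rewinding -/

section Circuit

variable {N q : ℕ}

/-- The operator of the `k`-th gate of the convolutional circuit on `N + 2` qudits. -/
def gateOp (U : Fin (N + 1) → TwoQuditUnitary q) (k : ℕ) :
    Matrix (Config (N + 2) q) (Config (N + 2) q) ℂ :=
  if h : k < N + 1 then pairOp ⟨k, by omega⟩ ⟨k + 1, by omega⟩ (U ⟨k, h⟩ : PairMatrix q) else 1

/-- The unitary of the first `k` gates of the convolutional circuit. -/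
def prefixOp (U : Fin (N + 1) → TwoQuditUnitary q) :
    ℕ → Matrix (Config (N + 2) q) (Config (N + 2) q) ℂ
  | 0 => 1
  | k + 1 => gateOp U k * prefixOp U k

theorem gateOp_of_lt (U : Fin (N + 1) → TwoQuditUnitary q) {k : ℕ} (h : k < N + 1) :
    gateOp U k = pairOp ⟨k, by omega⟩ ⟨k + 1, by omega⟩ (U ⟨k, h⟩ : PairMatrix q) := dif_pos h

theorem site_ne_succ {k : ℕ} (h : k < N + 1) :
    (⟨k, by omega⟩ : Fin (N + 2)) ≠ ⟨k + 1, by omega⟩ := by simp [Fin.ext_iff]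

theorem gateOp_conjTranspose_mul (U : Fin (N + 1) → TwoQuditUnitary q) (k : ℕ) :
    (gateOp U k)ᴴ * gateOp U k = 1 := by
  unfold gateOp
  split_ifs with h
  · have h2 : (U ⟨k, h⟩ : PairMatrix q)ᴴ * (U ⟨k, h⟩ : PairMatrix q) = 1 :=
      Matrix.mem_unitaryGroup_iff'.mp (U ⟨k, h⟩).2
    rw [← pairOp_conjTranspose, ← pairOp_mul (site_ne_succ h), h2, pairOp_one]
  · simp

theorem prefixOp_conjTranspose_mul (U : Fin (N + 1) → TwoQuditUnitary q) (k : ℕ) :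
    (prefixOp U k)ᴴ * prefixOp U k = 1 := by
  induction k with
  | zero => simp [prefixOp]
  | succ k ih =>
    rw [prefixOp, Matrix.conjTranspose_mul, Matrix.mul_assoc, ← Matrix.mul_assoc _ (gateOp U k),
      gateOp_conjTranspose_mul, Matrix.one_mul, ih]

theorem continuous_gateOp (k : ℕ) :
    Continuous fun U : Fin (N + 1) → TwoQuditUnitary q => gateOp U k := by
  unfold gateOp
  split_ifs with h
  · refine continuous_matrix fun x y => ?_
    simp only [pairOp_apply]
    split_ifs
    · exact (continuous_coe_gate.comp
        (continuous_apply (A := fun _ : Fin (N + 1) => TwoQuditUnitary q) ⟨k, h⟩)).matrix_elem _ _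
    · exact continuous_const
  · exact continuous_const

theorem continuous_prefixOp (k : ℕ) :
    Continuous fun U : Fin (N + 1) → TwoQuditUnitary q => prefixOp U k := by
  induction k with
  | zero => exact continuous_const
  | succ k ih => exact (continuous_gateOp k).matrix_mul ih

/-- The first `k` gates touch only sites `0, …, k`. -/
theorem commute_siteUnit_prefixOp (U : Fin (N + 1) → TwoQuditUnitary q) (k : ℕ) {s : Fin (N + 2)}
    (hs : k < s) (ab : Fin q × Fin q) : Commute (siteUnit s ab) (prefixOp U k) := by
  induction k with
  | zero => exact Commute.one_right _
  | succ k ih =>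
    refine Commute.mul_right ?_ (ih (by omega))
    rw [gateOp_of_lt U (by omega)]
    exact commute_siteUnit_pairOp (by simp [Fin.ext_iff]; omega) (by simp [Fin.ext_iff]; omega) _ _

theorem prefixOp_update (U : Fin (N + 1) → TwoQuditUnitary q) (j : Fin (N + 1))
    (W : TwoQuditUnitary q) (k : ℕ) (hk : k ≤ j) :
    prefixOp (Function.update U j W) k = prefixOp U k := by
  induction k with
  | zero => rfl
  | succ k ih =>
    rw [prefixOp, prefixOp, ih (by omega), gateOp_of_lt _ (by omega), gateOp_of_lt _ (by omega),
      Function.update_of_ne]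
    simp [Fin.ext_iff]
    omega

/-- The reduced Heisenberg evolution: pair operators conjugated by the first `k` gates. -/
def conjPair (U : Fin (N + 1) → TwoQuditUnitary q) (k : ℕ) (hk : k < N + 1) :
    PairMatrix q →ₗ[ℂ] Matrix (Config (N + 2) q) (Config (N + 2) q) ℂ where
  toFun M := (prefixOp U k)ᴴ * pairOp ⟨k, by omega⟩ ⟨k + 1, by omega⟩ M * prefixOp U k
  map_add' M N := by rw [map_add, Matrix.mul_add, Matrix.add_mul]
  map_smul' c M := by rw [map_smul, Matrix.mul_smul, Matrix.smul_mul]; rfl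

theorem conjPair_apply (U : Fin (N + 1) → TwoQuditUnitary q) {k : ℕ} (hk : k < N + 1)
    (M : PairMatrix q) : conjPair U k hk M
      = (prefixOp U k)ᴴ * pairOp ⟨k, by omega⟩ ⟨k + 1, by omega⟩ M * prefixOp U k := rfl

theorem conjPair_update (U : Fin (N + 1) → TwoQuditUnitary q) {k : ℕ} (hk : k < N + 1)
    (W : TwoQuditUnitary q) :
    (prefixOp U k)ᴴ * prefixOp (Function.update U ⟨k, hk⟩ W) (k + 1)
      = conjPair U k hk (W : PairMatrix q) := by
  rw [prefixOp, prefixOp_update _ _ _ _ le_rfl, gateOp_of_lt _ hk, Function.update_self,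
    conjPair_apply, Matrix.mul_assoc]

/-- The joint law of the independent Haar-random gates. -/
abbrev gateLaw (N q : ℕ) : Measure (Fin (N + 1) → TwoQuditUnitary q) :=
  Measure.pi fun _ => haarGate q

theorem integrable_gateLaw {f : (Fin (N + 1) → TwoQuditUnitary q) → ℂ} (hf : Continuous f) :
    Integrable f (gateLaw N q) :=
  hf.integrable_of_hasCompactSupport (HasCompactSupport.of_compactSpace f)

theorem prod_reverse_ofFn (U : Fin (N + 1) → TwoQuditUnitary q) (k : ℕ) :
    (List.ofFn fun a : Fin k => gateOp U a).reverse.prod = prefixOp U k := by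
  induction k with
  | zero => simp [prefixOp]
  | succ k ih =>
    rw [List.ofFn_succ', List.concat_eq_append, List.reverse_append, List.prod_append]
    simp only [Fin.val_castSucc, Fin.val_last, List.reverse_singleton, List.prod_singleton]
    rw [ih, prefixOp]

theorem circuitUnitary_convolutionalCircuit (U : Fin (N + 1) → TwoQuditUnitary q) :
    circuitUnitary (convolutionalCircuit (n := N + 2) U) = prefixOp U (N + 1) := by
  rw [← prod_reverse_ofFn, circuitUnitary, convolutionalCircuit, List.map_ofFn]
  congr 3
  ext1 a
  exact (gateOp_of_lt U a.2).symm

/-- Only the last gate reaches the non-idle site `N + 1`, so the filter drops just that one. -/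
theorem filter_convolutionalCircuit (U : Fin (N + 1) → TwoQuditUnitary q) :
    ((convolutionalCircuit (n := N + 2) U).filter fun g => g.support ⊆ idleQudits (N + 2)).map
      Gate.toMatrix = List.ofFn fun a : Fin N => gateOp U a := by
  have hlast : ∀ f : Fin (N + 1) → Gate (N + 2) q, (∀ a : Fin N, (f a.castSucc).support ⊆
      idleQudits (N + 2)) → ¬ (f (Fin.last N)).support ⊆ idleQudits (N + 2) →
      (List.ofFn f).filter (fun g => g.support ⊆ idleQudits (N + 2))
        = List.ofFn fun a : Fin N => f a.castSucc := by
    intro f h1 h2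
    rw [List.ofFn_succ', List.concat_eq_append, List.filter_append, List.filter_eq_self.mpr]
    · simp [h2]
    · intro g hg
      obtain ⟨a, rfl⟩ := List.mem_ofFn.mp hg
      simpa using h1 a
  refine (congrArg (List.map Gate.toMatrix) (hlast _ ?_ ?_)).trans ?_
  · intro a
    simp [Gate.support, idleQudits, Finset.insert_subset_iff]
  · simp [Gate.support, idleQudits, Finset.insert_subset_iff]
  · rw [List.map_ofFn]
    congr 1
    ext1 a
    exact (gateOp_of_lt U (by omega)).symm

theorem circuitUnitary_rewinding {n : ℕ} (idle : Finset (Fin n)) (C : List (Gate n q)) :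
    circuitUnitary (rewinding idle C)
      = (((C.filter fun g => g.support ⊆ idle).map Gate.toMatrix).reverse.prod)ᴴ := by
  rw [circuitUnitary, rewinding]
  generalize (C.filter fun g => g.support ⊆ idle) = L
  rw [List.map_reverse, List.reverse_reverse, List.map_map, Matrix.conjTranspose_list_prod,
    List.map_reverse, List.reverse_reverse, List.map_map]
  congr 2
  ext1 g
  exact pairOp_conjTranspose g.U.1

theorem conjPair_single (U : Fin (N + 1) → TwoQuditUnitary q) {k : ℕ} (hk : k < N + 1)
    (p : (Fin q × Fin q) × (Fin q × Fin q)) :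
    conjPair U k hk (Matrix.single p.1 p.2 1) = siteUnit ⟨k + 1, by omega⟩ (p.1.2, p.2.2) *
      ((prefixOp U k)ᴴ * siteUnit ⟨k, by omega⟩ (p.1.1, p.2.1) * prefixOp U k) := by
  -- The adjoint of the commutation relation for the swapped unit moves the site-`(k + 1)` unit past
  -- `(prefixOp U k)ᴴ`.
  have hc := congrArg Matrix.conjTranspose
    (commute_siteUnit_prefixOp U k (s := ⟨k + 1, by omega⟩) (Nat.lt_succ_self k)
      (p.2.2, p.1.2)).eq
  rw [Matrix.conjTranspose_mul, Matrix.conjTranspose_mul, siteUnit_conjTranspose,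
    Prod.swap_prod_mk] at hc
  rw [conjPair_apply, pairOp_single (site_ne_succ hk), ← Matrix.mul_assoc _ _ (prefixOp U k),
    ← Matrix.mul_assoc, ← Matrix.mul_assoc, hc]

theorem sum_regroup {κ : Type*} [Fintype κ] (F : κ × κ → κ × κ → ℂ) :
    ∑ p : (κ × κ) × (κ × κ), F (p.1.1, p.2.1) (p.1.2, p.2.2) = ∑ ab, ∑ cd, F ab cd := by
  rw [← (Equiv.prodProdProdComm κ κ κ κ).sum_comp, Fintype.sum_prod_type]
  rfl

/-! ### The recursion for the inserted weight -/

variable [NeZero q]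

/-- The diagonal element of `A† (|0⟩⟨0|₁ ⊗ I) A` at `|0^n⟩`. -/
def resetForm (A : Matrix (Config (N + 2) q) (Config (N + 2) q) ℂ) : ℂ :=
  quadForm (zeroProj 0) (fun _ => 0) A

/-- The total weight of reset after a local operator is inserted at site `k` and rewound. -/
def insertedForm (U : Fin (N + 1) → TwoQuditUnitary q) (k : ℕ) (hk : k < N + 2) : ℂ :=
  ∑ ab, resetForm ((prefixOp U k)ᴴ * siteUnit ⟨k, hk⟩ ab * prefixOp U k)

theorem resetForm_one : resetForm (1 : Matrix (Config (N + 2) q) (Config (N + 2) q) ℂ) = 1 := by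
  simp [resetForm, quadForm, zeroProj]

theorem continuous_insertedForm (k : ℕ) (hk : k < N + 2) :
    Continuous fun U : Fin (N + 1) → TwoQuditUnitary q => insertedForm U k hk :=
  continuous_finsetSum _ fun _ _ => continuous_quadForm _ _
    (((continuous_prefixOp k).matrix_conjTranspose.matrix_mul continuous_const).matrix_mul
      (continuous_prefixOp k))

/-- No gate has acted, and among the units on site `0` only `|0⟩⟨0|` maps `|0^n⟩` to a nonzero
vector in the range of the projector. -/
theorem insertedForm_zero (U : Fin (N + 1) → TwoQuditUnitary q) :
    insertedForm U 0 (by omega) = 1 := by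
  have h : ∀ ab : Fin q × Fin q, resetForm (siteUnit (0 : Fin (N + 2)) ab)
      = if ab = 0 then 1 else 0 := by
    intro ab
    rw [resetForm, quadForm, siteUnit_conjTranspose, zeroProj, Matrix.mul_apply,
      Finset.sum_eq_single fun _ => 0]
    · simp only [Matrix.mul_diagonal, siteUnit_apply, Prod.ext_iff, Prod.fst_swap, Prod.snd_swap]
      by_cases h1 : ab.1 = 0 <;> by_cases h2 : ab.2 = 0 <;> simp [h1, h2, eq_comm]
    · intro z _ hz
      rw [Matrix.mul_diagonal, siteUnit_apply]
      by_cases h0 : z 0 = 0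
      · rw [if_neg, zero_mul, zero_mul]
        rintro ⟨h, -⟩
        refine hz (funext fun k => ?_)
        by_cases hk : k = 0
        · rw [hk, h0]
        · exact (h k hk).symm
      · simp [h0]
    · simp
  simp [insertedForm, prefixOp, h]

theorem sum_resetForm_siteUnit_mul {k : ℕ} (hk : k < N + 1)
    (A : Matrix (Config (N + 2) q) (Config (N + 2) q) ℂ) :
    ∑ cd, resetForm (siteUnit ⟨k + 1, by omega⟩ cd * A) = q * resetForm A := by
  -- The new site is never the measured one, so its units commute with the projector.
  have hne : (⟨k + 1, by omega⟩ : Fin (N + 2)) ≠ 0 := by simp [Fin.ext_iff]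
  refine sum_quadForm_mul (P := zeroProj 0) (fun _ => 0)
    (sum_siteUnit ⟨k, by omega⟩ ⟨k + 1, by omega⟩ (site_ne_succ hk)) (fun cd => ?_) A
  rw [siteUnit_conjTranspose]
  exact commute_siteUnit_zeroProj hne _

theorem sum_resetForm_conjPair_single (U : Fin (N + 1) → TwoQuditUnitary q) {k : ℕ}
    (hk : k < N + 1) :
    ∑ p : (Fin q × Fin q) × (Fin q × Fin q),
        resetForm (conjPair U k hk (Matrix.single p.1 p.2 1))
      = q * insertedForm U k (by omega) := by
  have h : ∀ p : (Fin q × Fin q) × (Fin q × Fin q),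
      resetForm (conjPair U k hk (Matrix.single p.1 p.2 1)) = _ :=
    fun p => congrArg resetForm (conjPair_single U hk p)
  rw [Fintype.sum_congr _ _ h, sum_regroup fun ab cd =>
    resetForm (siteUnit ⟨k + 1, by omega⟩ cd *
      ((prefixOp U k)ᴴ * siteUnit ⟨k, by omega⟩ ab * prefixOp U k)), insertedForm, Finset.mul_sum]
  exact Finset.sum_congr rfl fun ab _ => sum_resetForm_siteUnit_mul hk _

theorem insertedForm_update (U : Fin (N + 1) → TwoQuditUnitary q) {k : ℕ} (hk : k < N + 1)
    (W : TwoQuditUnitary q) :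
    insertedForm (Function.update U ⟨k, hk⟩ W) (k + 1) (by omega)
      = ∑ ab, resetForm (conjPair U k hk (evolvedUnit ab W)) := by
  refine Finset.sum_congr rfl fun ab _ => ?_
  rw [prefixOp, prefixOp_update _ _ _ _ le_rfl, gateOp_of_lt _ hk, Function.update_self,
    conjPair_apply, evolvedUnit, pairOp_mul (site_ne_succ hk), pairOp_mul (site_ne_succ hk),
    pairOp_one_kronecker (site_ne_succ hk), pairOp_conjTranspose, Matrix.conjTranspose_mul]
  simp only [Matrix.mul_assoc]

theorem integral_insertedForm_update (hq : 2 ≤ q) (U : Fin (N + 1) → TwoQuditUnitary q) {k : ℕ}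
    (hk : k < N + 1) :
    ∫ W, insertedForm (Function.update U ⟨k, hk⟩ W) (k + 1) (by omega) ∂haarGate q
      = (q : ℂ) / (q ^ 2 + 1) * (1 + q * insertedForm U k (by omega)) := by
  simp only [insertedForm_update]
  rw [← sum_resetForm_conjPair_single U hk]
  refine (integral_quadForm_evolvedUnit hq _ _ (conjPair U k hk)).trans ?_
  congr 2
  rw [conjPair_apply, pairOp_one, Matrix.mul_one, prefixOp_conjTranspose_mul]
  exact resetForm_one

theorem integral_resetForm_update (hq : 2 ≤ q) (U : Fin (N + 1) → TwoQuditUnitary q) {k : ℕ}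
    (hk : k < N + 1) :
    ∫ W : TwoQuditUnitary q, resetForm ((prefixOp U k)ᴴ *
        prefixOp (Function.update U ⟨k, hk⟩ W) (k + 1)) ∂haarGate q
      = 1 / q * insertedForm U k (by omega) := by
  have hq0 : (q : ℂ) ≠ 0 := by exact_mod_cast (by omega : q ≠ 0)
  simp only [conjPair_update]
  refine (integral_quadForm_gate hq _ _ (conjPair U k hk)).trans ?_
  refine (congrArg (1 / (q : ℂ) ^ 2 * ·) (sum_resetForm_conjPair_single U hk)).trans ?_
  field_simp

/-- Solves the affine recursion of `integral_insertedForm_update`: the gap to the fixed point `q`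
starts at `q - 1` and shrinks by `q² / (q² + 1)` per gate. -/
theorem integral_insertedForm (hq : 2 ≤ q) (k : ℕ) (hk : k < N + 2) :
    ∫ U, insertedForm U k hk ∂gateLaw N q
      = q * (1 - ((q : ℂ) - 1) / q * ((q : ℂ) ^ 2 / ((q : ℂ) ^ 2 + 1)) ^ k) := by
  have hq0 : (q : ℂ) ≠ 0 := by exact_mod_cast (by omega : q ≠ 0)
  have hq1 : (q : ℂ) ^ 2 + 1 ≠ 0 := by exact_mod_cast (by positivity : q ^ 2 + 1 ≠ 0)
  induction k with
  | zero =>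
    simp only [insertedForm_zero]
    simp
    field_simp
    ring
  | succ k ih =>
    have hk' : k < N + 1 := by omega
    -- Resampling gate `k` averages it with all the other gates held fixed.
    rw [integral_eq_integral_update (haarGate q) ⟨k, hk'⟩
      (integrable_gateLaw (continuous_insertedForm _ _))]
    simp only [integral_insertedForm_update hq]
    rw [integral_const_mul, integral_add (integrable_const _)
      ((integrable_gateLaw (continuous_insertedForm _ _)).const_mul _), integral_const_mul, ih]
    simp only [integral_const, probReal_univ, one_smul]
    rw [pow_succ ((q : ℂ) ^ 2 / ((q : ℂ) ^ 2 + 1)) k]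
    generalize ((q : ℂ) ^ 2 / ((q : ℂ) ^ 2 + 1)) ^ k = r
    field_simp
    ring

/-- The operator `R U(C)` of the convolutional circuit followed by its rewinding. -/
def rewoundOp (U : Fin (N + 1) → TwoQuditUnitary q) :
    Matrix (Config (N + 2) q) (Config (N + 2) q) ℂ :=
  (prefixOp U N)ᴴ * prefixOp U (N + 1)

theorem continuous_resetForm_rewoundOp :
    Continuous fun U : Fin (N + 1) → TwoQuditUnitary q => resetForm (rewoundOp U) :=
  continuous_quadForm _ _
    ((continuous_prefixOp N).matrix_conjTranspose.matrix_mul (continuous_prefixOp (N + 1)))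

theorem integral_resetForm_rewoundOp (hq : 2 ≤ q) :
    ∫ U, resetForm (rewoundOp U) ∂gateLaw N q
      = 1 - ((q : ℂ) - 1) / q * ((q : ℂ) ^ 2 / ((q : ℂ) ^ 2 + 1)) ^ N := by
  have hq0 : (q : ℂ) ≠ 0 := by exact_mod_cast (by omega : q ≠ 0)
  rw [integral_eq_integral_update (haarGate q) ⟨N, by omega⟩
    (integrable_gateLaw continuous_resetForm_rewoundOp)]
  have h : ∀ U W, rewoundOp (Function.update U ⟨N, by omega⟩ W) = (prefixOp U N)ᴴ *
      prefixOp (Function.update U (⟨N, by omega⟩ : Fin (N + 1)) W : _ → TwoQuditUnitary q)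
        (N + 1) := by
    intro U W
    rw [rewoundOp, prefixOp_update _ _ _ _ le_rfl]
  simp only [h, integral_resetForm_update hq]
  rw [integral_const_mul, integral_insertedForm hq]
  field_simp

/-- The inner product is already real by `fidelity_eq_sum`, so the real part in `fidelity` loses
nothing. -/
theorem convFidelity_eq_resetForm (hn : 2 ≤ N + 2) (U : Fin (N + 1) → TwoQuditUnitary q) :
    (convFidelity (N + 2) hn U : ℂ) = resetForm (rewoundOp U) := by
  rw [convFidelity, fidelity, fidelity_eq_sum, Complex.ofReal_re, ← fidelity_eq_sum, rewoundState,
    circuitUnitary_rewinding, filter_convolutionalCircuit, prod_reverse_ofFn,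
    circuitUnitary_convolutionalCircuit, ← rewoundOp, zeroState, Matrix.mulVec_single_one,
    resetForm, quadForm, Matrix.mul_assoc]
  rfl

end Circuit

/-! ### The averaged fidelity as a real number -/

section Average

variable {q : ℕ} [NeZero q]

theorem integrable_convFidelity (N : ℕ) (hn : 2 ≤ N + 2) :
    Integrable (fun U => convFidelity (q := q) (N + 2) hn U)
      (Measure.pi fun _ : Fin (N + 2 - 1) => haarGate q) := by
  have h : Integrable (fun U => (resetForm (rewoundOp U)).re) (gateLaw N q) :=
    (integrable_gateLaw continuous_resetForm_rewoundOp).re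
  simp only [← convFidelity_eq_resetForm hn, Complex.ofReal_re] at h
  exact h

theorem avgFidelity_eq (hq : 2 ≤ q) (N : ℕ) (hn : 2 ≤ N + 2) :
    avgFidelity q (N + 2) hn
      = 1 - ((q : ℝ) - 1) / q * ((q : ℝ) ^ 2 / ((q : ℝ) ^ 2 + 1)) ^ N := by
  have h := integral_resetForm_rewoundOp (N := N) hq
  simp only [← convFidelity_eq_resetForm hn] at h
  rw [integral_complex_ofReal] at h
  apply Complex.ofReal_injective
  push_cast
  exact h

end Average

end ConvCircuit

end

theorem mainTheorem1 (q : ℕ) [NeZero q] (hq : 2 ≤ q) :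
    (∀ (n : ℕ) (hn : 2 ≤ n),
      Integrable (fun U => ConvCircuit.convFidelity n hn U)
          (Measure.pi fun _ : Fin (n - 1) => ConvCircuit.haarGate q) ∧
        ConvCircuit.avgFidelity q n hn
          = 1 - ((q : ℝ) - 1) / q * ((q : ℝ) ^ 2 / ((q : ℝ) ^ 2 + 1)) ^ (n - 2)) ∧
      Tendsto (fun m : ℕ => 1 - ConvCircuit.avgFidelity q (m + 2) (Nat.le_add_left 2 m))
        atTop (𝓝 0) ∧
      Tendsto
        (fun m : ℕ =>
          (1 - ConvCircuit.avgFidelity q (m + 1 + 2) (Nat.le_add_left 2 (m + 1))) /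
            (1 - ConvCircuit.avgFidelity q (m + 2) (Nat.le_add_left 2 m)))
        atTop (𝓝 ((q : ℝ) ^ 2 / ((q : ℝ) ^ 2 + 1))) := by
  have hq' : (2 : ℝ) ≤ q := by exact_mod_cast hq
  have hr0 : 0 < (q : ℝ) ^ 2 / ((q : ℝ) ^ 2 + 1) := by positivity
  have hr1 : (q : ℝ) ^ 2 / ((q : ℝ) ^ 2 + 1) < 1 := by
    rw [div_lt_one (by positivity)]
    linarith
  have hc : 0 < ((q : ℝ) - 1) / q := div_pos (by linarith) (by linarith)
  refine ⟨fun n hn => ?_, ?_, ?_⟩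
  · obtain ⟨N, rfl⟩ : ∃ N, n = N + 2 := ⟨n - 2, by omega⟩
    exact ⟨ConvCircuit.integrable_convFidelity N hn, ConvCircuit.avgFidelity_eq hq N hn⟩
  · simp only [ConvCircuit.avgFidelity_eq hq, sub_sub_cancel]
    simpa using (tendsto_pow_atTop_nhds_zero_of_lt_one hr0.le hr1).const_mul (((q : ℝ) - 1) / q)
  · simp only [ConvCircuit.avgFidelity_eq hq, sub_sub_cancel]
    -- The infidelity is exactly geometric, so the ratio is constant.
    refine tendsto_const_nhds.congr fun m => ?_
    rw [pow_succ _ m, ← mul_assoc, mul_div_cancel_left₀]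
    exact (mul_pos hc (pow_pos hr0 m)).ne'
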